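/- Let $\mathcal P$ be the set of all probability measures $P$ on $\mathbb R$ such that $L(t)=\int_{\mathbb R} e^{tx}\,P(dx)<\infty$ for every $t\in\mathbb R$ and such that, with $P_t(dx)=\frac{e^{tx}}{L(t)}\,P(dx)$, the number $t$ is a median of $P_t$ for every $t\in\mathbb R$, that is, $$P_t((-\infty,t))\le \tfrac12\le P_t((-\infty,t])\qquad\text{for all } t\in\mathbb R.$$ Then $\mathcal P=\{N(0,1)\}$: the standard normal law belongs to $\mathcal P$, and it is the only element of $\mathcal P$. -/

import Mathlib

open MeasureTheory ProbabilityTheory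

/-- The real number `m` is a median of the measure `Q` on the real line:
`Q((-∞, m)) ≤ 1/2 ≤ Q((-∞, m])`. -/
def IsMedian (Q : Measure ℝ) (m : ℝ) : Prop :=
  Q (Set.Iio m) ≤ 1 / 2 ∧ 1 / 2 ≤ Q (Set.Iic m)

/-- The member `P_t(dx) = e^{tx} P(dx) / L(t)` of the natural exponential family generated by `P`,
where `L(t) = ∫ e^{tx} P(dx)`. -/
noncomputable def expFamily (P : Measure ℝ) (t : ℝ) : Measure ℝ :=
  P.tilted (fun x => t * x)

/-- The class of all probabilities `P` on the real line whose Laplace transform is finite at every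
real `t` and for which the natural parameter `t` is a median of `P_t` for every real `t`. -/
def medianClass : Set (Measure ℝ) :=
  {P | IsProbabilityMeasure P ∧
    (∀ t : ℝ, Integrable (fun x => Real.exp (t * x)) P) ∧
    ∀ t : ℝ, IsMedian (expFamily P t) t}

/-!
The normal law is in the class because tilting it by `e^{tx}` translates it by `t`.

Conversely, let `P` be in the class. A one-sided limit in `t` upgrades the two median inequalities
to equalities (`setIntegral_exp_mul_of_mem_medianClass`), so `P` has no atoms. Put
`ν(dx) = e^{x²/2} P(dx)`. Completing the square, the median condition says that the convolution of
`ν` with `sign(z) e^{-z²/2}` vanishes. The distributional derivative of this kernel is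
`2 (δ₀ - m)`, where `m(z) = |z| e^{-z²/2} / 2` is a symmetric probability density, so that `ν` is
harmonic: `ν = ν * m`. In integrated form, for every `a > 0` the function `u(t) = ν((t - a, t])` is
continuous and `u = u * m` (`lintegral_rayleighKernel_mul_gaussianQuotient_Ioc`).

Nonnegative harmonic functions of this walk are constant (`eq_of_harmonic_rayleighKernel`), by the
following elementary argument. With `h = 1 / (1 + u)`, Jensen's inequality gives `h * m - h = D ≥ 0`
with an explicit quadratic defect `D`. For `ρ(x) = e^{-ε|x|}` one has `ρ * m ≤ ρ / (1 - ε²)`, hence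
`∫ ρ D = ∫ h (ρ * m - ρ) ≤ ε² / (1 - ε²) * ∫ ρ = 2 ε / (1 - ε²)`. Letting `ε → 0` yields `D = 0`, and
`u` is constant because `m` vanishes only at `0`.

Therefore `ν` is translation invariant, a multiple of Lebesgue measure, and `P` is the standard
normal law.
-/

/-! ### Exponential tilting of the normal law -/

theorem gaussianReal_tilted_mul (t : ℝ) :
    (gaussianReal 0 1).tilted (fun x => t * x) = gaussianReal t 1 := by
  have hL : ∫ x, Real.exp (t * x) ∂(gaussianReal 0 1) = Real.exp (t ^ 2 / 2) := by
    have := mgf_id_gaussianReal (μ := 0) (v := 1)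
    have := congrFun this t
    simpa [mgf] using this
  rw [Measure.tilted, hL, gaussianReal_of_var_ne_zero 0 one_ne_zero,
    gaussianReal_of_var_ne_zero t one_ne_zero,
    ← withDensity_mul _ (measurable_gaussianPDF 0 1) (by fun_prop)]
  congr 1
  ext x
  simp only [Pi.mul_apply, gaussianPDF]
  rw [← ENNReal.ofReal_mul (gaussianPDFReal_nonneg _ _ _)]
  congr 1
  simp only [gaussianPDFReal, mul_assoc, ← Real.exp_sub, ← Real.exp_add]
  congr 3
  push_cast
  ring

theorem isMedian_gaussianReal (t : ℝ) : IsMedian (gaussianReal t 1) t := by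
  have hsymm : gaussianReal t 1 (Set.Iio t) = gaussianReal t 1 (Set.Ioi t) := by
    have h : (gaussianReal t 1).map (fun x => 2 * t - x) = gaussianReal t 1 := by
      rw [gaussianReal_map_const_sub]; congr 1; ring
    conv_lhs => rw [← h]
    rw [Measure.map_apply (by fun_prop) measurableSet_Iio]
    congr 1
    ext x
    simp only [Set.mem_preimage, Set.mem_Iio, Set.mem_Ioi]
    constructor <;> intro <;> linarith
  have hle : gaussianReal t 1 (Set.Iio t) ≤ gaussianReal t 1 (Set.Iic t) :=
    measure_mono Set.Iio_subset_Iic_self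
  have hsum : gaussianReal t 1 (Set.Iic t) + gaussianReal t 1 (Set.Ioi t) = 1 := by
    rw [← Set.compl_Iic, prob_add_prob_compl measurableSet_Iic]
  have heq : gaussianReal t 1 (Set.Iio t) = gaussianReal t 1 (Set.Iic t) := by
    have := nullSingletonClass_gaussianReal (μ := t) (v := 1) one_ne_zero
    exact measure_congr Iio_ae_eq_Iic
  have h2 : gaussianReal t 1 (Set.Iic t) * 2 = 1 := by
    rw [mul_two]; nth_rw 2 [← heq]; rw [hsymm, hsum]
  have h3 : gaussianReal t 1 (Set.Iic t) = 1 / 2 := by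
    rw [ENNReal.eq_div_iff (by norm_num) (by norm_num), mul_comm, h2]
  exact ⟨heq ▸ h3.le, h3.ge⟩

theorem gaussianReal_mem_medianClass : gaussianReal 0 1 ∈ medianClass := by
  refine ⟨inferInstance, fun t => integrable_exp_mul_gaussianReal t, fun t => ?_⟩
  rw [expFamily, gaussianReal_tilted_mul]
  exact isMedian_gaussianReal t

/-! ### The symmetrized Rayleigh kernel -/

/-- The density `|z| e^{-z²/2} / 2` of the symmetrized Rayleigh law, a probability density on the
real line. -/
noncomputable def rayleighKernel (z : ℝ) : ℝ := |z| / 2 * Real.exp (-(z ^ 2 / 2))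

theorem rayleighKernel_nonneg (z : ℝ) : 0 ≤ rayleighKernel z := by
  unfold rayleighKernel; positivity

theorem continuous_rayleighKernel : Continuous rayleighKernel := by
  unfold rayleighKernel; fun_prop

@[fun_prop]
theorem measurable_rayleighKernel : Measurable rayleighKernel :=
  continuous_rayleighKernel.measurable

theorem rayleighKernel_neg (z : ℝ) : rayleighKernel (-z) = rayleighKernel z := by
  simp [rayleighKernel]

theorem integral_abs_mul_exp_neg_mul_sq {b : ℝ} (hb : 0 < b) :
    ∫ z : ℝ, |z| * Real.exp (-b * z ^ 2) = 1 / b := by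
  have h1 := integral_comp_abs (f := fun z : ℝ => z * Real.exp (-b * z ^ 2))
  simp only [sq_abs] at h1
  rw [h1]
  have h2 := integral_rpow_mul_exp_neg_mul_rpow (p := 2) (q := 1) (b := b) (by norm_num)
    (by norm_num) hb
  norm_num [Real.rpow_neg_one] at h2
  simp only [neg_mul]
  rw [h2]
  field_simp

theorem integrable_abs_mul_exp_neg_mul_sq {b : ℝ} (hb : 0 < b) :
    Integrable fun z : ℝ => |z| * Real.exp (-b * z ^ 2) := by
  have := (integrable_mul_exp_neg_mul_sq hb).norm
  simpa [abs_mul] using this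

theorem integrable_exp_mul_rayleighKernel {ε : ℝ} (hε : |ε| < 1) :
    Integrable fun z : ℝ => Real.exp (ε * z) * rayleighKernel z := by
  have hb : 0 < (1 - ε ^ 2) / 2 := by
    have := (sq_lt_one_iff_abs_lt_one ε).2 hε
    linarith
  refine (integrable_abs_mul_exp_neg_mul_sq hb).mono' (by fun_prop) (ae_of_all _ fun z => ?_)
  rw [Real.norm_of_nonneg (mul_nonneg (Real.exp_pos _).le (rayleighKernel_nonneg z))]
  have h1 : Real.exp (ε * z) ≤ 2 * Real.exp ((ε * z) ^ 2 / 2) := by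
    have h := Real.cosh_le_exp_half_sq (ε * z)
    rw [Real.cosh_eq] at h
    linarith [Real.exp_pos (-(ε * z))]
  have h2 : Real.exp (-((1 - ε ^ 2) / 2) * z ^ 2)
      = Real.exp ((ε * z) ^ 2 / 2) * Real.exp (-(z ^ 2 / 2)) := by
    rw [← Real.exp_add]; congr 1; ring
  rw [h2, rayleighKernel]
  calc Real.exp (ε * z) * (|z| / 2 * Real.exp (-(z ^ 2 / 2)))
      ≤ 2 * Real.exp ((ε * z) ^ 2 / 2) * (|z| / 2 * Real.exp (-(z ^ 2 / 2))) := by gcongr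
    _ = _ := by ring

/-- The Laplace transform of the symmetrized Rayleigh law is `1 + O(ε²)`: by symmetry `e^{εz}` may
be replaced by `cosh (εz) ≤ e^{ε²z²/2}`. -/
theorem integral_exp_mul_rayleighKernel_le {ε : ℝ} (hε : |ε| < 1) :
    ∫ z : ℝ, Real.exp (ε * z) * rayleighKernel z ≤ 1 / (1 - ε ^ 2) := by
  have hb : 0 < (1 - ε ^ 2) / 2 := by
    have := (sq_lt_one_iff_abs_lt_one ε).2 hε
    linarith
  have hi := integrable_exp_mul_rayleighKernel hε
  have hi' := integrable_exp_mul_rayleighKernel (ε := -ε) (by rwa [abs_neg])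
  have hsymm : ∫ z : ℝ, Real.exp (-ε * z) * rayleighKernel z
      = ∫ z : ℝ, Real.exp (ε * z) * rayleighKernel z := by
    rw [← integral_neg_eq_self (fun z : ℝ => Real.exp (ε * z) * rayleighKernel z) volume]
    simp [rayleighKernel_neg]
  have hle : ∫ z : ℝ, (Real.exp (ε * z) * rayleighKernel z
      + Real.exp (-ε * z) * rayleighKernel z) ≤
      ∫ z : ℝ, |z| * Real.exp (-((1 - ε ^ 2) / 2) * z ^ 2) := by
    refine integral_mono (hi.add hi') (integrable_abs_mul_exp_neg_mul_sq hb) fun z => ?_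
    have h1 := Real.cosh_le_exp_half_sq (ε * z)
    have h2 : Real.exp (-((1 - ε ^ 2) / 2) * z ^ 2)
        = Real.exp ((ε * z) ^ 2 / 2) * Real.exp (-(z ^ 2 / 2)) := by
      rw [← Real.exp_add]; congr 1; ring
    rw [Real.cosh_eq] at h1
    beta_reduce
    rw [h2]
    simp only [rayleighKernel, neg_mul]
    calc _ = (Real.exp (ε * z) + Real.exp (-(ε * z))) / 2 * (|z| * Real.exp (-(z ^ 2 / 2))) := by
          ring
      _ ≤ Real.exp ((ε * z) ^ 2 / 2) * (|z| * Real.exp (-(z ^ 2 / 2))) := by gcongr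
      _ = _ := by ring
  rw [integral_add hi hi', hsymm, integral_abs_mul_exp_neg_mul_sq hb, one_div_div] at hle
  have : 2 / (1 - ε ^ 2) = 2 * (1 / (1 - ε ^ 2)) := by ring
  linarith

theorem lintegral_rayleighKernel : ∫⁻ z : ℝ, ENNReal.ofReal (rayleighKernel z) = 1 := by
  have hi := integrable_exp_mul_rayleighKernel (ε := 0) (by simp)
  simp only [zero_mul, Real.exp_zero, one_mul] at hi
  rw [← ofReal_integral_eq_lintegral_ofReal hi (ae_of_all _ rayleighKernel_nonneg)]
  have h : ∀ z, rayleighKernel z = 1 / 2 * (|z| * Real.exp (-(1 / 2) * z ^ 2)) := fun z => by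
    rw [rayleighKernel]; ring_nf
  simp only [h]
  rw [integral_const_mul, integral_abs_mul_exp_neg_mul_sq (by norm_num)]
  norm_num

/-- `e^{-ε|x|}` is almost superharmonic for the symmetrized Rayleigh law: it is the minimum of the
two eigenfunctions `e^{εx}` and `e^{-εx}`. -/
theorem lintegral_exp_neg_abs_mul_rayleighKernel_le {ε : ℝ} (h0 : 0 ≤ ε) (h1 : ε < 1) (y : ℝ) :
    ∫⁻ x : ℝ, ENNReal.ofReal (Real.exp (-(ε * |x|)) * rayleighKernel (x - y))
      ≤ ENNReal.ofReal (Real.exp (-(ε * |y|))) * ENNReal.ofReal (1 / (1 - ε ^ 2)) := by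
  obtain ⟨δ, hδ, hδy, hδle⟩ : ∃ δ : ℝ, |δ| < 1 ∧ δ * y = -(ε * |y|) ∧
      δ ^ 2 = ε ^ 2 ∧ ∀ x, -(ε * |x|) ≤ δ * x := by
    rcases le_total 0 y with hy | hy
    · refine ⟨-ε, by rwa [abs_neg, abs_of_nonneg h0], by rw [abs_of_nonneg hy]; ring, by ring,
        fun x => ?_⟩
      nlinarith [le_abs_self x]
    · refine ⟨ε, by rwa [abs_of_nonneg h0], by rw [abs_of_nonpos hy]; ring, rfl, fun x => ?_⟩
      nlinarith [neg_abs_le x]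
  have hi := integrable_exp_mul_rayleighKernel hδ
  calc ∫⁻ x : ℝ, ENNReal.ofReal (Real.exp (-(ε * |x|)) * rayleighKernel (x - y))
      = ∫⁻ z : ℝ, ENNReal.ofReal (Real.exp (-(ε * |z + y|)) * rayleighKernel z) := by
        rw [← lintegral_add_right_eq_self _ y]; simp
    _ ≤ ∫⁻ z : ℝ, ENNReal.ofReal (Real.exp (-(ε * |y|))) *
          ENNReal.ofReal (Real.exp (δ * z) * rayleighKernel z) := by
        refine lintegral_mono fun z => ?_
        rw [← ENNReal.ofReal_mul (Real.exp_pos _).le, ← mul_assoc, ← Real.exp_add]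
        refine ENNReal.ofReal_le_ofReal (mul_le_mul_of_nonneg_right ?_ (rayleighKernel_nonneg z))
        refine Real.exp_le_exp.2 ?_
        linarith [hδle.2 (z + y)]
    _ = ENNReal.ofReal (Real.exp (-(ε * |y|))) *
          ∫⁻ z : ℝ, ENNReal.ofReal (Real.exp (δ * z) * rayleighKernel z) :=
        lintegral_const_mul _ (by fun_prop)
    _ ≤ _ := by
        gcongr
        rw [← ofReal_integral_eq_lintegral_ofReal hi (ae_of_all _ fun z =>
          mul_nonneg (Real.exp_pos _).le (rayleighKernel_nonneg z)), ← hδle.1]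
        exact ENNReal.ofReal_le_ofReal (integral_exp_mul_rayleighKernel_le hδ)

theorem lintegral_exp_neg_mul_abs {ε : ℝ} (h0 : 0 < ε) :
    ∫⁻ x : ℝ, ENNReal.ofReal (Real.exp (-(ε * |x|))) = ENNReal.ofReal (2 / ε) := by
  have hval : ∫ x : ℝ, Real.exp (-(ε * |x|)) = 2 / ε := by
    rw [integral_comp_abs (f := fun x : ℝ => Real.exp (-(ε * x)))]
    have := integral_exp_mul_Ioi (neg_lt_zero.2 h0) 0
    simp only [neg_mul] at this
    rw [this]; simp; ring
  have hint : Integrable fun x : ℝ => Real.exp (-(ε * |x|)) := by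
    -- a non-integrable function would have Bochner integral `0`
    refine not_imp_comm.1 integral_undef ?_
    rw [hval]; positivity
  rw [← ofReal_integral_eq_lintegral_ofReal hint (ae_of_all _ fun x => (Real.exp_pos _).le), hval]

theorem continuous_sign_mul_one_sub_exp :
    Continuous fun z : ℝ => Real.sign z * (1 - Real.exp (-(z ^ 2 / 2))) / 2 := by
  have h : (fun z : ℝ => Real.sign z * (1 - Real.exp (-(z ^ 2 / 2))) / 2) = fun z : ℝ =>
      if 0 ≤ z then (1 - Real.exp (-(z ^ 2 / 2))) / 2
      else -((1 - Real.exp (-(z ^ 2 / 2))) / 2) := by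
    ext z
    rcases lt_trichotomy z 0 with hz | rfl | hz
    · rw [if_neg hz.not_ge, Real.sign_of_neg hz]; ring
    · simp
    · rw [if_pos hz.le, Real.sign_of_pos hz]; ring
  rw [h]
  refine Continuous.if_le (by fun_prop) (by fun_prop) continuous_const continuous_id ?_
  rintro z rfl
  simp

/-- The kernel has the primitive `sign z * (1 - e^{-z²/2}) / 2`. -/
theorem integral_rayleighKernel (p q : ℝ) :
    ∫ z in p..q, rayleighKernel z =
      Real.sign q * (1 - Real.exp (-(q ^ 2 / 2))) / 2
        - Real.sign p * (1 - Real.exp (-(p ^ 2 / 2))) / 2 := by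
  refine integral_eq_of_hasDerivAt_off_countable
    (fun z : ℝ => Real.sign z * (1 - Real.exp (-(z ^ 2 / 2))) / 2) rayleighKernel
    (Set.countable_singleton 0) continuous_sign_mul_one_sub_exp.continuousOn (fun z hz => ?_)
    (continuous_rayleighKernel.intervalIntegrable _ _)
  have hd : HasDerivAt (fun z : ℝ => (1 - Real.exp (-(z ^ 2 / 2))) / 2)
      (z / 2 * Real.exp (-(z ^ 2 / 2))) z := by
    have h1 : HasDerivAt (fun z : ℝ => -(z ^ 2 / 2)) (-z) z := by
      refine ((hasDerivAt_pow 2 z).div_const 2).fun_neg.congr_deriv ?_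
      norm_num
    refine ((h1.exp.const_sub 1).div_const 2).congr_deriv ?_
    ring
  rcases lt_or_gt_of_ne (show z ≠ 0 from hz.2) with h | h
  · refine HasDerivAt.congr_of_eventuallyEq (f := fun z : ℝ => -((1 - Real.exp (-(z ^ 2 / 2))) / 2))
      ?_ ?_
    · refine hd.fun_neg.congr_deriv ?_
      rw [rayleighKernel, abs_of_neg h]; ring
    · filter_upwards [Iio_mem_nhds h] with w hw
      rw [Real.sign_of_neg hw]; ring
  · refine HasDerivAt.congr_of_eventuallyEq (f := fun z : ℝ => (1 - Real.exp (-(z ^ 2 / 2))) / 2)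
      ?_ ?_
    · refine hd.congr_deriv ?_
      rw [rayleighKernel, abs_of_pos h]
    · filter_upwards [Ioi_mem_nhds h] with w hw
      rw [Real.sign_of_pos hw]; ring

theorem lintegral_Ico_rayleighKernel {a : ℝ} (ha : 0 ≤ a) (t x : ℝ) :
    ∫⁻ y in Set.Ico x (x + a), ENNReal.ofReal (rayleighKernel (t - y)) =
      ENNReal.ofReal (∫ z in (t - x - a)..(t - x), rayleighKernel z) := by
  have hc : Continuous fun y => rayleighKernel (t - y) :=
    continuous_rayleighKernel.comp (by fun_prop)
  rw [restrict_Ico_eq_restrict_Ioc,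
    ← ofReal_integral_eq_lintegral_ofReal
      ((hc.intervalIntegrable x (x + a)).1.mono_set (by simp))
      (ae_of_all _ fun y => rayleighKernel_nonneg _),
    ← intervalIntegral.integral_of_le (by linarith),
    intervalIntegral.integral_comp_sub_left (fun z => rayleighKernel z)]
  congr 2
  ring

/-! ### Harmonic functions of the symmetrized Rayleigh walk -/

/-- Jensen's inequality for the convex function `s ↦ 1 / (1 + s)` and a harmonic `u`, with its exact
defect: it integrates the identity
`1 / (1 + b) = 1 / (1 + a) - (b - a) / (1 + a) ^ 2 + (b - a) ^ 2 / ((1 + b) * (1 + a) ^ 2)`,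
whose linear term contributes nothing. -/
theorem lintegral_rayleighKernel_div_one_add {u : ℝ → ℝ} (hu0 : ∀ x, 0 ≤ u x)
    (hum : Measurable u)
    (hu : ∀ x, ∫⁻ y, ENNReal.ofReal (rayleighKernel (x - y) * u y) = ENNReal.ofReal (u x))
    (x : ℝ) :
    ∫⁻ y, ENNReal.ofReal (rayleighKernel (x - y) * (1 / (1 + u y))) =
      (∫⁻ y, ENNReal.ofReal (rayleighKernel (x - y) *
        ((u y - u x) ^ 2 / ((1 + u y) * (1 + u x) ^ 2)))) + ENNReal.ofReal (1 / (1 + u x)) := by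
  set k : ℝ := 1 / (1 + u x) ^ 2 with hk
  have hx := hu0 x
  have hk0 : 0 ≤ k := by positivity
  have hm := fun y => rayleighKernel_nonneg (x - y)
  have hmass : ∫⁻ y, ENNReal.ofReal (rayleighKernel (x - y)) = 1 := by
    rw [lintegral_sub_left_eq_self (fun y => ENNReal.ofReal (rayleighKernel y)) x,
      lintegral_rayleighKernel]
  have hlin : ∫⁻ y, ENNReal.ofReal (rayleighKernel (x - y) * u y * k) = ENNReal.ofReal (u x * k) := by
    rw [ENNReal.ofReal_mul hx, ← hu x, ← lintegral_mul_const _ (by fun_prop)]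
    exact lintegral_congr fun y => ENNReal.ofReal_mul (mul_nonneg (hm y) (hu0 y))
  have hcst : ∫⁻ y, ENNReal.ofReal (rayleighKernel (x - y) * (1 / (1 + u x) + u x * k))
      = ENNReal.ofReal (1 / (1 + u x)) + ENNReal.ofReal (u x * k) := by
    rw [← ENNReal.ofReal_add (by positivity) (by positivity), ← one_mul (ENNReal.ofReal _),
      ← hmass, ← lintegral_mul_const _ (by fun_prop)]
    exact lintegral_congr fun y => ENNReal.ofReal_mul (hm y)
  -- the linear term is moved to the left so that every integrand is nonnegative
  have key : (∫⁻ y, ENNReal.ofReal (rayleighKernel (x - y) * (1 / (1 + u y))))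
      + ENNReal.ofReal (u x * k) =
      (∫⁻ y, ENNReal.ofReal (rayleighKernel (x - y) *
        ((u y - u x) ^ 2 / ((1 + u y) * (1 + u x) ^ 2))))
      + (ENNReal.ofReal (1 / (1 + u x)) + ENNReal.ofReal (u x * k)) := by
    rw [← hlin, ← lintegral_add_left (by fun_prop), hlin, ← hcst, ← lintegral_add_left (by fun_prop)]
    refine lintegral_congr fun y => ?_
    have hy := hu0 y
    rw [← ENNReal.ofReal_add (mul_nonneg (hm y) (by positivity))
        (mul_nonneg (mul_nonneg (hm y) hy) hk0),
      ← ENNReal.ofReal_add (mul_nonneg (hm y) (by positivity)) (mul_nonneg (hm y) (by positivity))]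
    congr 1
    rw [hk]
    field_simp
    ring
  rw [← add_assoc] at key
  exact (ENNReal.add_left_inj ENNReal.ofReal_ne_top).1 key

/-- The Jensen defect of `1 / (1 + u)`, tested against `e^{-ε|x|}`. Moving the kernel onto the test
function bounds it by `ε² / (1 - ε²)` times the integral of `e^{-ε|x|}`, which is `2 / ε`; as
`1 / (1 + u) ≤ 1`, no bound on `u` is needed. -/
theorem lintegral_exp_neg_abs_mul_defect_le {u : ℝ → ℝ} (hu0 : ∀ x, 0 ≤ u x)
    (hum : Measurable u)
    (hu : ∀ x, ∫⁻ y, ENNReal.ofReal (rayleighKernel (x - y) * u y) = ENNReal.ofReal (u x))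
    {ε : ℝ} (h0 : 0 < ε) (h1 : ε < 1) :
    ∫⁻ x, ENNReal.ofReal (Real.exp (-(ε * |x|))) *
        (∫⁻ y, ENNReal.ofReal (rayleighKernel (x - y) *
          ((u y - u x) ^ 2 / ((1 + u y) * (1 + u x) ^ 2)))) ≤
      ENNReal.ofReal (2 * ε / (1 - ε ^ 2)) := by
  have hε : 0 < 1 - ε ^ 2 := by nlinarith
  set I : ENNReal := ∫⁻ x, ENNReal.ofReal (Real.exp (-(ε * |x|))) * ENNReal.ofReal (1 / (1 + u x))
    with hI
  have hIle : I ≤ ENNReal.ofReal (2 / ε) := by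
    rw [← lintegral_exp_neg_mul_abs h0]
    refine lintegral_mono fun x => mul_le_of_le_one_right' ?_
    rw [← ENNReal.ofReal_one]
    refine ENNReal.ofReal_le_ofReal ?_
    rw [div_le_one (by linarith [hu0 x])]
    linarith [hu0 x]
  have hItop : I ≠ ⊤ := ne_top_of_le_ne_top ENNReal.ofReal_ne_top hIle
  have hmeas : Measurable fun x => ENNReal.ofReal (Real.exp (-(ε * |x|))) *
      ENNReal.ofReal (1 / (1 + u x)) := by fun_prop
  have hswap : ∫⁻ x, ENNReal.ofReal (Real.exp (-(ε * |x|))) *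
        (∫⁻ y, ENNReal.ofReal (rayleighKernel (x - y) * (1 / (1 + u y)))) ≤
      I * ENNReal.ofReal (1 / (1 - ε ^ 2)) := by
    calc _ = ∫⁻ x, ∫⁻ y, ENNReal.ofReal (1 / (1 + u y)) *
          ENNReal.ofReal (Real.exp (-(ε * |x|)) * rayleighKernel (x - y)) := by
          refine lintegral_congr fun x => ?_
          rw [← lintegral_const_mul _ (by fun_prop)]
          refine lintegral_congr fun y => ?_
          rw [ENNReal.ofReal_mul (rayleighKernel_nonneg _), ENNReal.ofReal_mul (Real.exp_pos _).le]
          ring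
      _ = ∫⁻ y, ∫⁻ x, ENNReal.ofReal (1 / (1 + u y)) *
          ENNReal.ofReal (Real.exp (-(ε * |x|)) * rayleighKernel (x - y)) :=
          lintegral_lintegral_swap (by fun_prop)
      _ = ∫⁻ y, ENNReal.ofReal (1 / (1 + u y)) *
          ∫⁻ x, ENNReal.ofReal (Real.exp (-(ε * |x|)) * rayleighKernel (x - y)) :=
          lintegral_congr fun y => lintegral_const_mul _ (by fun_prop)
      _ ≤ ∫⁻ y, ENNReal.ofReal (1 / (1 + u y)) * (ENNReal.ofReal (Real.exp (-(ε * |y|))) *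
          ENNReal.ofReal (1 / (1 - ε ^ 2))) := by
          gcongr with y
          exact lintegral_exp_neg_abs_mul_rayleighKernel_le h0.le h1 y
      _ = I * ENNReal.ofReal (1 / (1 - ε ^ 2)) := by
          rw [hI, ← lintegral_mul_const _ hmeas]
          refine lintegral_congr fun y => ?_
          ring
  simp only [lintegral_rayleighKernel_div_one_add hu0 hum hu, mul_add] at hswap
  rw [lintegral_add_right _ hmeas, ← hI] at hswap
  have hsplit : I * ENNReal.ofReal (1 / (1 - ε ^ 2)) =
      I * ENNReal.ofReal (ε ^ 2 / (1 - ε ^ 2)) + I := by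
    have : 1 / (1 - ε ^ 2) = ε ^ 2 / (1 - ε ^ 2) + 1 := by field_simp; ring
    rw [this, ENNReal.ofReal_add (by positivity) zero_le_one, ENNReal.ofReal_one, mul_add, mul_one]
  rw [hsplit] at hswap
  calc _ ≤ I * ENNReal.ofReal (ε ^ 2 / (1 - ε ^ 2)) := (ENNReal.add_le_add_iff_right hItop).1 hswap
    _ ≤ ENNReal.ofReal (2 / ε) * ENNReal.ofReal (ε ^ 2 / (1 - ε ^ 2)) := by gcongr
    _ = ENNReal.ofReal (2 * ε / (1 - ε ^ 2)) := by
        rw [← ENNReal.ofReal_mul (by positivity)]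
        congr 1
        field_simp

/-- A Liouville theorem: nonnegative continuous functions harmonic for the random walk with
symmetrized Rayleigh steps are constant. The Jensen defect of the bounded function `1 / (1 + u)` vanishes. -/
theorem eq_of_harmonic_rayleighKernel {u : ℝ → ℝ} (hu0 : ∀ x, 0 ≤ u x) (huc : Continuous u)
    (hu : ∀ x, ∫⁻ y, ENNReal.ofReal (rayleighKernel (x - y) * u y) = ENNReal.ofReal (u x))
    (x y : ℝ) : u x = u y := by
  have hum := huc.measurable
  set D : ℝ → ENNReal := fun x => ∫⁻ y, ENNReal.ofReal (rayleighKernel (x - y) *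
          ((u y - u x) ^ 2 / ((1 + u y) * (1 + u x) ^ 2))) with hD
  have hDm : Measurable D := by
    rw [hD]
    exact Measurable.lintegral_prod_right' (f := fun p : ℝ × ℝ =>
      ENNReal.ofReal (rayleighKernel (p.1 - p.2) *
        ((u p.2 - u p.1) ^ 2 / ((1 + u p.2) * (1 + u p.1) ^ 2)))) (by fun_prop)
  have hzero : ∫⁻ x, ENNReal.ofReal (Real.exp (-(1 * |x|))) * D x = 0 := by
    have hlim : Filter.Tendsto (fun ε : ℝ => ENNReal.ofReal (2 * ε / (1 - ε ^ 2)))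
        (nhdsWithin 0 (Set.Ioi 0)) (nhds 0) := by
      have hc : ContinuousAt (fun ε : ℝ => 2 * ε / (1 - ε ^ 2)) 0 :=
        ContinuousAt.div (by fun_prop) (by fun_prop) (by norm_num)
      have := ENNReal.tendsto_ofReal hc.tendsto
      simp only [mul_zero, zero_div, ENNReal.ofReal_zero] at this
      exact this.mono_left nhdsWithin_le_nhds
    refine le_antisymm (ge_of_tendsto hlim ?_) zero_le
    filter_upwards [Ioo_mem_nhdsGT (zero_lt_one' ℝ)] with ε hε
    refine le_trans (lintegral_mono fun x => ?_)
      (lintegral_exp_neg_abs_mul_defect_le hu0 hum hu hε.1 hε.2)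
    gcongr
    exact hε.2.le
  rw [lintegral_eq_zero_iff (by fun_prop)] at hzero
  obtain ⟨x₀, hx₀⟩ := hzero.exists
  have hDx : D x₀ = 0 := by
    have h := (mul_eq_zero.1 hx₀).resolve_left (by simp [Real.exp_pos])
    exact h
  rw [hD, lintegral_eq_zero_iff (by fun_prop)] at hDx
  have hae : u =ᵐ[volume] fun _ => u x₀ := by
    filter_upwards [hDx, Measure.ae_ne volume x₀] with y hy hne
    have hpos : 0 < rayleighKernel (x₀ - y) := by
      have : 0 < |x₀ - y| := abs_pos.2 (sub_ne_zero.2 hne.symm)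
      unfold rayleighKernel; positivity
    have h1 := hu0 y
    have h2 := hu0 x₀
    have h3 := ENNReal.ofReal_eq_zero.1 hy
    by_contra hne'
    have h4 : 0 < (u y - u x₀) ^ 2 := by
      have := sub_ne_zero.2 hne'
      positivity
    have : 0 < rayleighKernel (x₀ - y) *
        ((u y - u x₀) ^ 2 / ((1 + u y) * (1 + u x₀) ^ 2)) := by positivity
    linarith
  have hcst := (huc.ae_eq_iff_eq volume continuous_const).1 hae
  rw [congrFun hcst x, congrFun hcst y]

/-! ### The median condition as an equation between integrals -/

section MedianClass

variable {P : Measure ℝ}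

theorem isMedian_expFamily_iff [IsProbabilityMeasure P] {t : ℝ}
    (hint : Integrable (fun x => Real.exp (t * x)) P) :
    IsMedian (expFamily P t) t ↔
      2 * ∫ x in Set.Iio t, Real.exp (t * x) ∂P ≤ ∫ x, Real.exp (t * x) ∂P ∧
      ∫ x, Real.exp (t * x) ∂P ≤ 2 * ∫ x in Set.Iic t, Real.exp (t * x) ∂P := by
  have hL : 0 < ∫ x, Real.exp (t * x) ∂P := integral_exp_pos hint
  have hhalf : (1 / 2 : ENNReal) = ENNReal.ofReal (1 / 2) := by
    rw [ENNReal.ofReal_div_of_pos two_pos]; simp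
  have hnn : ∀ s : Set ℝ, 0 ≤ ∫ x in s, Real.exp (t * x) ∂P := fun s =>
    integral_nonneg fun x => (Real.exp_pos _).le
  rw [IsMedian, expFamily, tilted_apply_eq_ofReal_integral, tilted_apply_eq_ofReal_integral, hhalf,
    integral_div, integral_div, ENNReal.ofReal_le_ofReal_iff (by norm_num),
    ENNReal.ofReal_le_ofReal_iff (div_nonneg (hnn _) hL.le), div_le_div_iff₀ hL two_pos,
    div_le_div_iff₀ two_pos hL]
  constructor <;> rintro ⟨h1, h2⟩ <;> constructor <;> linarith

/-- The integral of `e^{rx}` over a set `s r` tends to that of `e^{tx}` over `s'` when the indicators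
of `s r` converge pointwise to that of `s'`. In the application `r` tends to `t` from one side, so
that closed half-lines converge to open ones and conversely. -/
theorem tendsto_setIntegral_exp_mul [IsProbabilityMeasure P]
    (hint : ∀ t : ℝ, Integrable (fun x => Real.exp (t * x)) P) {t : ℝ} {l : Filter ℝ}
    [l.IsCountablyGenerated] (hl : l ≤ nhds t) {s : ℝ → Set ℝ} (hs : ∀ r, MeasurableSet (s r))
    {s' : Set ℝ} (hs' : MeasurableSet s') (h : ∀ x, ∀ᶠ r in l, x ∈ s r ↔ x ∈ s') :
    Filter.Tendsto (fun r => ∫ x in s r, Real.exp (r * x) ∂P) l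
      (nhds (∫ x in s', Real.exp (t * x) ∂P)) := by
  simp only [← integral_indicator (hs _), ← integral_indicator hs']
  refine tendsto_integral_filter_of_dominated_convergence
    (fun x => Real.exp ((t - 1) * x) + Real.exp ((t + 1) * x))
    (.of_forall fun r => Measurable.aestronglyMeasurable
      (Measurable.indicator (by fun_prop) (hs r))) ?_ ((hint _).add (hint _)) (ae_of_all _ fun x => ?_)
  · filter_upwards [hl (Ioo_mem_nhds (show t - 1 < t by linarith) (show t < t + 1 by linarith))]
      with r hr
    refine ae_of_all _ fun x => (norm_indicator_le_norm_self _ _).trans ?_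
    rw [Real.norm_of_nonneg (Real.exp_pos _).le]
    rcases le_total 0 x with hx | hx
    · have : Real.exp (r * x) ≤ Real.exp ((t + 1) * x) :=
        Real.exp_le_exp.2 (mul_le_mul_of_nonneg_right hr.2.le hx)
      linarith [Real.exp_pos ((t - 1) * x)]
    · have : Real.exp (r * x) ≤ Real.exp ((t - 1) * x) :=
        Real.exp_le_exp.2 (mul_le_mul_of_nonpos_right hr.1.le hx)
      linarith [Real.exp_pos ((t + 1) * x)]
  · have hc : Filter.Tendsto (fun r => s'.indicator (fun x => Real.exp (r * x)) x) l
        (nhds (s'.indicator (fun x => Real.exp (t * x)) x)) := by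
      by_cases hx : x ∈ s'
      · simp only [Set.indicator_of_mem hx]
        exact (Continuous.tendsto (by fun_prop) t).mono_left hl
      · simp only [Set.indicator_of_notMem hx]
        exact tendsto_const_nhds
    refine hc.congr' ?_
    filter_upwards [h x] with r hr
    by_cases hx : x ∈ s'
    · rw [Set.indicator_of_mem hx, Set.indicator_of_mem (hr.2 hx)]
    · rw [Set.indicator_of_notMem hx, Set.indicator_of_notMem (fun h => hx (hr.1 h))]

/-- Both median inequalities are equalities: the inequality at `r` for the closed half-line passes,
as `r` increases to `t`, to the reverse inequality for the open half-line at `t`, and symmetrically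
from the right. -/
theorem setIntegral_exp_mul_of_mem_medianClass (hP : P ∈ medianClass) (t : ℝ) :
    2 * ∫ x in Set.Iio t, Real.exp (t * x) ∂P = ∫ x, Real.exp (t * x) ∂P ∧
      2 * ∫ x in Set.Iic t, Real.exp (t * x) ∂P = ∫ x, Real.exp (t * x) ∂P := by
  obtain ⟨_, hint, hmed⟩ := hP
  have hmed' := fun t => (isMedian_expFamily_iff (hint t)).1 (hmed t)
  have hfull : ∀ l : Filter ℝ, l.IsCountablyGenerated → l ≤ nhds t →
      Filter.Tendsto (fun r => ∫ x, Real.exp (r * x) ∂P) l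
        (nhds (∫ x, Real.exp (t * x) ∂P)) := fun l _ hl => by
    simpa using tendsto_setIntegral_exp_mul hint hl (s := fun _ => Set.univ)
      (fun _ => MeasurableSet.univ) MeasurableSet.univ (by simp)
  constructor
  · refine le_antisymm (hmed' t).1 (le_of_tendsto_of_tendsto'
      (hfull (nhdsWithin t (Set.Iio t)) inferInstance nhdsWithin_le_nhds)
      ((tendsto_setIntegral_exp_mul hint (l := nhdsWithin t (Set.Iio t)) nhdsWithin_le_nhds
        (fun _ => measurableSet_Iic) measurableSet_Iio fun x => ?_).const_mul 2)
      fun r => (hmed' r).2)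
    rcases lt_or_ge x t with hx | hx
    · filter_upwards [Ioo_mem_nhdsLT hx] with r hr
      simp [hx, hr.1.le]
    · filter_upwards [self_mem_nhdsWithin] with r hr
      simp only [Set.mem_Iic, Set.mem_Iio] at hr ⊢
      constructor <;> intro <;> linarith
  · refine le_antisymm (le_of_tendsto_of_tendsto'
      ((tendsto_setIntegral_exp_mul hint (l := nhdsWithin t (Set.Ioi t)) nhdsWithin_le_nhds
        (fun _ => measurableSet_Iio) measurableSet_Iic fun x => ?_).const_mul 2)
      (hfull (nhdsWithin t (Set.Ioi t)) inferInstance nhdsWithin_le_nhds)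
      fun r => (hmed' r).1) (hmed' t).2
    rcases le_or_gt x t with hx | hx
    · filter_upwards [self_mem_nhdsWithin] with r hr
      simp only [Set.mem_Iic, Set.mem_Iio, Set.mem_Ioi] at hr ⊢
      constructor <;> intro <;> linarith
    · filter_upwards [Ioo_mem_nhdsGT hx] with r hr
      simp only [Set.mem_Iic, Set.mem_Iio, Set.mem_Ioo] at hr ⊢
      constructor <;> intro <;> linarith

theorem nullSingletonClass_of_mem_medianClass (hP : P ∈ medianClass) : NullSingletonClass P := by
  refine ⟨fun t => ?_⟩
  obtain ⟨h1, h2⟩ := setIntegral_exp_mul_of_mem_medianClass hP t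
  obtain ⟨_, hint, _⟩ := hP
  rw [← Set.Iio_union_right, setIntegral_union (by simp) (measurableSet_singleton t)
    (hint t).integrableOn (hint t).integrableOn, integral_singleton] at h2
  have h3 : P.real {t} * Real.exp (t * t) = 0 := by
    rw [smul_eq_mul] at h2; linarith
  have h4 := (mul_eq_zero.1 h3).resolve_right (Real.exp_pos _).ne'
  exact (measureReal_eq_zero_iff (by simp)).1 h4

theorem integral_sign_mul_exp_of_mem_medianClass (hP : P ∈ medianClass) (t : ℝ) :
    Integrable (fun x => Real.sign (t - x) * Real.exp (t * x)) P ∧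
      ∫ x, Real.sign (t - x) * Real.exp (t * x) ∂P = 0 := by
  have h := setIntegral_exp_mul_of_mem_medianClass hP t
  have hint := hP.2.1
  have hsign : ∀ x, Real.sign (t - x) * Real.exp (t * x) =
      (Set.Iio t).indicator (fun x => Real.exp (t * x)) x +
        (Set.Iic t).indicator (fun x => Real.exp (t * x)) x - Real.exp (t * x) := fun x => by
    rcases lt_trichotomy x t with hx | rfl | hx
    · rw [Real.sign_of_pos (by linarith), Set.indicator_of_mem (by simpa using hx),
        Set.indicator_of_mem (by simpa using hx.le)]
      ring
    · simp
    · rw [Real.sign_of_neg (by linarith), Set.indicator_of_notMem (by simpa using hx.le),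
        Set.indicator_of_notMem (by simpa using hx)]
      ring
  have h1 := (hint t).indicator (measurableSet_Iio (a := t))
  have h2 := (hint t).indicator (measurableSet_Iic (a := t))
  simp only [hsign]
  refine ⟨(h1.add h2).sub (hint t), ?_⟩
  rw [integral_sub (by exact h1.add h2) (hint t), integral_add h1 h2, integral_indicator measurableSet_Iio,
    integral_indicator measurableSet_Iic]
  linarith

end MedianClass

/-! ### Translation invariance of the quotient by the Gaussian density -/

/-- The measure `e^{x²/2} P(dx)`; it is a multiple of Lebesgue measure exactly when `P` is a
multiple of the standard normal law. -/
noncomputable def gaussianQuotient (P : Measure ℝ) : Measure ℝ :=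
  P.withDensity fun x => ENNReal.ofReal (Real.exp (x ^ 2 / 2))

section GaussianQuotient

variable {P : Measure ℝ}

instance [IsProbabilityMeasure P] : IsLocallyFiniteMeasure (gaussianQuotient P) :=
  IsLocallyFiniteMeasure.withDensity_ofReal (by fun_prop)

instance [IsProbabilityMeasure P] : SFinite (gaussianQuotient P) := by
  unfold gaussianQuotient; infer_instance

theorem withDensity_gaussianQuotient (P : Measure ℝ) :
    (gaussianQuotient P).withDensity (fun x => ENNReal.ofReal (Real.exp (-(x ^ 2 / 2)))) = P := by
  rw [gaussianQuotient, ← withDensity_mul _ (by fun_prop) (by fun_prop)]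
  convert withDensity_one
  ext x
  rw [Pi.mul_apply, ← ENNReal.ofReal_mul (Real.exp_pos _).le, ← Real.exp_add]
  simp

theorem nullSingletonClass_gaussianQuotient (hP : P ∈ medianClass) :
    NullSingletonClass (gaussianQuotient P) := by
  have := nullSingletonClass_of_mem_medianClass hP
  exact ⟨fun x => withDensity_absolutelyContinuous _ _ (measure_singleton x)⟩

/-- Completing the square in `e^{tx} = e^{t²/2} e^{-(t-x)²/2} e^{x²/2}` turns the median condition
into a convolution equation for `e^{x²/2} P(dx)`. -/
theorem integral_sign_mul_exp_gaussianQuotient (hP : P ∈ medianClass) (t : ℝ) :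
    Integrable (fun x => Real.sign (t - x) * Real.exp (-((t - x) ^ 2 / 2))) (gaussianQuotient P) ∧
      ∫ x, Real.sign (t - x) * Real.exp (-((t - x) ^ 2 / 2)) ∂(gaussianQuotient P) = 0 := by
  obtain ⟨h1, h2⟩ := integral_sign_mul_exp_of_mem_medianClass hP t
  have hsq : ∀ x, Real.exp (x ^ 2 / 2) * (Real.sign (t - x) * Real.exp (-((t - x) ^ 2 / 2))) =
      Real.exp (-(t ^ 2 / 2)) * (Real.sign (t - x) * Real.exp (t * x)) := fun x => by
    have : Real.exp (x ^ 2 / 2) * Real.exp (-((t - x) ^ 2 / 2)) =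
        Real.exp (-(t ^ 2 / 2)) * Real.exp (t * x) := by
      rw [← Real.exp_add, ← Real.exp_add]; congr 1; ring
    linear_combination Real.sign (t - x) * this
  have hfin : ∀ᵐ x ∂P, ENNReal.ofReal (Real.exp (x ^ 2 / 2)) < ⊤ :=
    ae_of_all _ fun x => ENNReal.ofReal_lt_top
  constructor
  · rw [gaussianQuotient, integrable_withDensity_iff (by fun_prop) hfin]
    refine (h1.const_mul (Real.exp (-(t ^ 2 / 2)))).congr (ae_of_all _ fun x => ?_)
    simp only [← hsq, ENNReal.toReal_ofReal (Real.exp_pos _).le]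
    ring
  · rw [gaussianQuotient, integral_withDensity_eq_integral_toReal_smul (by fun_prop) hfin]
    simp only [ENNReal.toReal_ofReal (Real.exp_pos _).le, smul_eq_mul, hsq]
    rw [integral_const_mul, h2, mul_zero]

/-- The mass of a sliding window of fixed length `a` is harmonic for the symmetrized Rayleigh walk:
the primitive of the kernel is the step function `sign / 2` minus the kernel
`sign(z) e^{-z²/2} / 2`, whose convolution with `e^{x²/2} P(dx)` vanishes. -/
theorem lintegral_rayleighKernel_mul_gaussianQuotient_Ioc (hP : P ∈ medianClass) {a : ℝ}
    (ha : 0 < a) (t : ℝ) :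
    ∫⁻ y, ENNReal.ofReal (rayleighKernel (t - y) *
        (gaussianQuotient P).real (Set.Ioc (y - a) y)) =
      ENNReal.ofReal ((gaussianQuotient P).real (Set.Ioc (t - a) t)) := by
  have := hP.1
  have := nullSingletonClass_gaussianQuotient hP
  set ν := gaussianQuotient P
  obtain ⟨hi, h0⟩ := integral_sign_mul_exp_gaussianQuotient hP t
  obtain ⟨hi', h0'⟩ := integral_sign_mul_exp_gaussianQuotient hP (t - a)
  have hset : MeasurableSet {p : ℝ × ℝ | p.2 ∈ Set.Ioc (p.1 - a) p.1} := by
    have h1 : MeasurableSet {p : ℝ × ℝ | p.1 - a < p.2} :=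
      measurableSet_lt (by fun_prop) (by fun_prop)
    have h2 : MeasurableSet {p : ℝ × ℝ | p.2 ≤ p.1} :=
      measurableSet_le (by fun_prop) (by fun_prop)
    exact h1.inter h2
  have hpt : ∀ x, x ≠ t → x ≠ t - a →
      ∫ z in (t - x - a)..(t - x), rayleighKernel z =
        (Set.Ioc (t - a) t).indicator 1 x
          - Real.sign (t - x) * Real.exp (-((t - x) ^ 2 / 2)) / 2
          + Real.sign (t - a - x) * Real.exp (-((t - a - x) ^ 2 / 2)) / 2 := fun x hx hxa => by
    rw [integral_rayleighKernel, show t - x - a = t - a - x by ring]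
    rcases lt_or_gt_of_ne hx with h | h
    · rcases lt_or_gt_of_ne hxa with h' | h'
      · rw [Real.sign_of_pos (sub_pos.2 h), Real.sign_of_pos (sub_pos.2 h'),
          Set.indicator_of_notMem (by simp [h'.le])]
        ring
      · rw [Real.sign_of_pos (sub_pos.2 h), Real.sign_of_neg (sub_neg.2 h'),
          Set.indicator_of_mem (Set.mem_Ioc.2 ⟨h', h.le⟩), Pi.one_apply]
        ring
    · rw [Real.sign_of_neg (sub_neg.2 h), Real.sign_of_neg (by linarith),
        Set.indicator_of_notMem (by simp [h])]
      ring
  calc ∫⁻ y, ENNReal.ofReal (rayleighKernel (t - y) * ν.real (Set.Ioc (y - a) y))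
      = ∫⁻ y, ∫⁻ x, {p : ℝ × ℝ | p.2 ∈ Set.Ioc (p.1 - a) p.1}.indicator
          (fun p => ENNReal.ofReal (rayleighKernel (t - p.1))) (y, x) ∂ν := by
        refine lintegral_congr fun y => ?_
        rw [ENNReal.ofReal_mul (rayleighKernel_nonneg _), ofReal_measureReal measure_Ioc_lt_top.ne,
          ← lintegral_indicator_const measurableSet_Ioc]
        rfl
    _ = ∫⁻ x, (∫⁻ y, {p : ℝ × ℝ | p.2 ∈ Set.Ioc (p.1 - a) p.1}.indicator
          (fun p => ENNReal.ofReal (rayleighKernel (t - p.1))) (y, x)) ∂ν := by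
        refine lintegral_lintegral_swap (Measurable.aemeasurable ?_)
        exact Measurable.indicator (by fun_prop) hset
    _ = ∫⁻ x, ENNReal.ofReal (∫ z in (t - x - a)..(t - x), rayleighKernel z) ∂ν := by
        refine lintegral_congr fun x => ?_
        rw [← lintegral_Ico_rayleighKernel ha.le, ← lintegral_indicator measurableSet_Ico]
        refine lintegral_congr fun y => ?_
        have hiff : (y, x) ∈ {p : ℝ × ℝ | p.2 ∈ Set.Ioc (p.1 - a) p.1} ↔
            y ∈ Set.Ico x (x + a) := by
          simp only [Set.mem_ofPred_eq, Set.mem_Ioc, Set.mem_Ico]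
          constructor <;> rintro ⟨h1, h2⟩ <;> constructor <;> linarith
        by_cases hy : y ∈ Set.Ico x (x + a)
        · rw [Set.indicator_of_mem hy, Set.indicator_of_mem (hiff.2 hy)]
        · rw [Set.indicator_of_notMem hy, Set.indicator_of_notMem (fun h => hy (hiff.1 h))]
    _ = ENNReal.ofReal (∫ x, (∫ z in (t - x - a)..(t - x), rayleighKernel z) ∂ν) := ?_
    _ = ENNReal.ofReal (ν.real (Set.Ioc (t - a) t)) := ?_
  all_goals
    have hae : (fun x => ∫ z in (t - x - a)..(t - x), rayleighKernel z) =ᵐ[ν]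
        fun x => (Set.Ioc (t - a) t).indicator 1 x
          - Real.sign (t - x) * Real.exp (-((t - x) ^ 2 / 2)) / 2
          + Real.sign (t - a - x) * Real.exp (-((t - a - x) ^ 2 / 2)) / 2 := by
      filter_upwards [Measure.ae_ne ν t, Measure.ae_ne ν (t - a)] with x hx hx'
      exact hpt x hx hx'
    have hind : Integrable ((Set.Ioc (t - a) t).indicator (1 : ℝ → ℝ)) ν :=
      (integrable_indicator_iff measurableSet_Ioc).2 (integrableOn_const measure_Ioc_lt_top.ne)
  · refine (ofReal_integral_eq_lintegral_ofReal ?_ (ae_of_all _ fun x => ?_)).symm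
    · exact ((hind.sub (hi.div_const 2)).add (hi'.div_const 2)).congr hae.symm
    · exact intervalIntegral.integral_nonneg (by linarith) fun z _ => rayleighKernel_nonneg z
  · rw [integral_congr_ae hae, integral_add (by exact hind.sub (hi.div_const 2)) (hi'.div_const 2),
      integral_sub hind (hi.div_const 2), integral_div, integral_div, h0, h0',
      integral_indicator_one measurableSet_Ioc]
    simp

theorem continuous_measureReal_Ioc_sub (ν : Measure ℝ) [IsLocallyFiniteMeasure ν]
    [NullSingletonClass ν] {a : ℝ} (ha : 0 ≤ a) :
    Continuous fun t => ν.real (Set.Ioc (t - a) t) := by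
  have hI : ∀ p q : ℝ, IntervalIntegrable (fun _ => (1 : ℝ)) ν p q := fun p q =>
    intervalIntegrable_const
  have hc := intervalIntegral.continuous_primitive hI 0
  have h : (fun t => ν.real (Set.Ioc (t - a) t)) = fun t =>
      (∫ _ in (0 : ℝ)..t, (1 : ℝ) ∂ν) - ∫ _ in (0 : ℝ)..(t - a), (1 : ℝ) ∂ν := by
    ext t
    rw [intervalIntegral.integral_interval_sub_left (hI _ _) (hI _ _),
      intervalIntegral.integral_of_le (by linarith)]
    simp
  rw [h]
  exact hc.sub (hc.comp (by fun_prop))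

theorem isAddLeftInvariant_gaussianQuotient (hP : P ∈ medianClass) :
    (gaussianQuotient P).IsAddLeftInvariant := by
  have := hP.1
  have := nullSingletonClass_gaussianQuotient hP
  refine ⟨fun g => (Measure.ext_of_Ioc _ _ fun p q hpq => ?_).symm⟩
  rw [Measure.map_apply (by fun_prop) measurableSet_Ioc, Set.preimage_const_add_Ioc,
    ← measureReal_eq_measureReal_iff measure_Ioc_lt_top.ne measure_Ioc_lt_top.ne]
  have h := eq_of_harmonic_rayleighKernel (fun _ => measureReal_nonneg)
    (continuous_measureReal_Ioc_sub (gaussianQuotient P) (sub_pos.2 hpq).le)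
    (lintegral_rayleighKernel_mul_gaussianQuotient_Ioc hP (sub_pos.2 hpq)) q (q - g)
  rwa [sub_sub_cancel, show q - g - (q - p) = p - g by ring] at h

end GaussianQuotient

theorem gaussianReal_zero_one_eq_smul :
    gaussianReal 0 1 = ENNReal.ofReal (√(2 * Real.pi))⁻¹ •
      (volume : Measure ℝ).withDensity fun x => ENNReal.ofReal (Real.exp (-(x ^ 2 / 2))) := by
  rw [gaussianReal_of_var_ne_zero 0 one_ne_zero, ← withDensity_smul _ (by fun_prop)]
  congr 1
  ext x
  rw [Pi.smul_apply, smul_eq_mul, ← ENNReal.ofReal_mul (by positivity), gaussianPDF,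
    gaussianPDFReal]
  simp [neg_div]

theorem eq_gaussianReal_of_mem_medianClass {P : Measure ℝ} (hP : P ∈ medianClass) :
    P = gaussianReal 0 1 := by
  have := hP.1
  have := isAddLeftInvariant_gaussianQuotient hP
  obtain ⟨c, hc⟩ : ∃ c : ENNReal, gaussianQuotient P = c • volume :=
    ⟨_, Measure.isAddLeftInvariant_eq_smul (gaussianQuotient P) volume⟩
  have hPG := withDensity_gaussianQuotient P
  rw [hc, withDensity_smul_measure] at hPG
  have hG := gaussianReal_zero_one_eq_smul
  set G := (volume : Measure ℝ).withDensity fun x => ENNReal.ofReal (Real.exp (-(x ^ 2 / 2)))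
  -- both measures are multiples of `G`, so their total masses determine the factors
  have h1 : c * G Set.univ = 1 := by
    have h := measure_univ (μ := P)
    rwa [← hPG] at h
  have h2 : ENNReal.ofReal (√(2 * Real.pi))⁻¹ * G Set.univ = 1 := by
    have h := measure_univ (μ := gaussianReal 0 1)
    rwa [hG] at h
  rw [← hPG, hG, ENNReal.eq_inv_of_mul_eq_one_left h1, ENNReal.eq_inv_of_mul_eq_one_left h2]

theorem theorem1 : medianClass = {gaussianReal 0 1} := by
  ext P
  rw [Set.mem_singleton_iff]
  exact ⟨eq_gaussianReal_of_mem_medianClass, fun h => h ▸ gaussianReal_mem_medianClass⟩
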